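/- Let $T$ be a (finite, simple) tree with $n \ge 1$ vertices, let $C_4$ be the cycle with four vertices, let $C_4\times T$ denote the Cartesian product of graphs, and let $\mathrm{Pm}(G)$ denote the number of perfect matchings of a graph $G$. Then $\mathrm{Pm}(C_4\times T)$ is a perfect square or twice a perfect square. Moreover, if $T$ has a perfect matching, then $\mathrm{Pm}(C_4\times T)$ is a perfect square. Furthermore, let $\phi(T,x)=\det(xI-A(T))$ be the characteristic polynomial of the adjacency matrix $A(T)$ of $T$, let $r$ be the maximum number of edges in a matching of $T$, and let $s=n-2r$ (so that $s \ge 0$). Then $$\mathrm{Pm}(C_4\times T)=(-1)^s\,\phi(T,i\sqrt2)^2,\qquad i^2=-1.$$ -/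

import Mathlib

/-- `Pm(G)`: the number of perfect matchings of the graph `G`. A perfect matching is a spanning
subgraph in which every vertex has exactly one neighbour; it is determined by its edge set. -/
noncomputable def numPerfectMatchings {V : Type*} (G : SimpleGraph V) : ℕ :=
  Nat.card {M : G.Subgraph // M.IsPerfectMatching}

/-- `r` is the maximum number of edges in a matching of `G`. -/
def IsMaximumMatchingSize {V : Type*} (G : SimpleGraph V) (r : ℕ) : Prop :=
  IsGreatest {k : ℕ | ∃ M : G.Subgraph, M.IsMatching ∧ M.edgeSet.ncard = k} r

/-!
A perfect matching of `C₄ □ T` amounts to four matchings of `T`, one in each layer, together with a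
perfect matching, at each vertex `v` of `T`, of the part of the four-cycle over `v` that the layers
leave uncovered (`numPerfectMatchings_boxProd`). So the count is a sum over quadruples of matchings of
`T` of a product of local weights, one for each vertex.

This sum is embedded into a family with a positive real parameter at each vertex, `cyclePartition T x`,
with all parameters equal to `√2` in the original problem. The weights are chosen to be stable under
removing a leaf: summing over the ways in which the edge from a leaf `v` to its neighbour `u` is used
in the four layers gives weights of the same shape, with `x u` replaced by `x u + (x v)⁻¹`
(`sum_cycleWeight_sdiff_mul_compl`, `cyclePartition_deleteEdges`). Gaussian elimination at the leaf
changes `det (diag x + i A(T))` in exactly the same way (`det_signedMatrix_deleteEdges`). Both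
reductions end at the edgeless graph, where the partition function is `∏ (x v) ^ 2` and the
determinant is `∏ x v`; hence the partition function of a forest is the square of the determinant
(`SimpleGraph.IsAcyclic.cyclePartition_eq_det_sq`).

At `x = √2` the determinant is `φ(T, i√2)` up to the factor `i ^ n`, which gives the formula for the
number of perfect matchings. Since `φ` has integer coefficients, `φ(T, i√2) = a + b i √2` with integers
`a` and `b`. Its square being real, one of them is zero, so the count is `a ^ 2` or `2 b ^ 2`. If `T`
has a perfect matching, then `n` is even, the count is `a ^ 2 - 2 b ^ 2 ≥ 0`, and this forces `b = 0`.
-/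

open Finset

/-! ### Matchings as involutions -/

/-- A matching of `G`, encoded as the involution that exchanges the two ends of each of its edges and
fixes the unmatched vertices. -/
def IsMatchingInvolution {V : Type*} (G : SimpleGraph V) (f : V → V) : Prop :=
  ∀ v, f (f v) = v ∧ (f v = v ∨ G.Adj v (f v))

instance {V : Type*} [Fintype V] [DecidableEq V] (G : SimpleGraph V) [DecidableRel G.Adj]
    (f : V → V) : Decidable (IsMatchingInvolution G f) :=
  inferInstanceAs (Decidable (∀ v, f (f v) = v ∧ (f v = v ∨ G.Adj v (f v))))

/-- The spanning subgraph whose edges are the pairs exchanged by a fixed-point-free matching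
involution. -/
def subgraphOfInvolution {V : Type*} {G : SimpleGraph V} (f : V → V)
    (hf : ∀ v, f (f v) = v ∧ G.Adj v (f v)) : G.Subgraph where
  verts := Set.univ
  Adj a b := f a = b
  adj_sub := by rintro a b rfl; exact (hf a).2
  edge_vert _ := trivial
  symm := ⟨by rintro a b rfl; exact (hf a).1⟩

theorem subgraphOfInvolution_isPerfectMatching {V : Type*} {G : SimpleGraph V} (f : V → V)
    (hf : ∀ v, f (f v) = v ∧ G.Adj v (f v)) : (subgraphOfInvolution f hf).IsPerfectMatching := by
  rw [SimpleGraph.Subgraph.isPerfectMatching_iff]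
  exact fun v => ⟨f v, rfl, fun w hw => Eq.symm hw⟩

/-- Perfect matchings correspond to the matching involutions without fixed points. -/
noncomputable def perfectMatchingEquiv {V : Type*} (G : SimpleGraph V) :
    {M : G.Subgraph // M.IsPerfectMatching} ≃ {f : V → V // ∀ v, f (f v) = v ∧ G.Adj v (f v)} where
  toFun M := ⟨fun v => (SimpleGraph.Subgraph.isPerfectMatching_iff.1 M.2 v).choose, fun v => by
    have h := fun v => (SimpleGraph.Subgraph.isPerfectMatching_iff.1 M.2 v).choose_spec
    exact ⟨((h _).2 _ (h v).1.symm).symm, M.1.adj_sub (h v).1⟩⟩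
  invFun f := ⟨subgraphOfInvolution f.1 f.2, subgraphOfInvolution_isPerfectMatching f.1 f.2⟩
  left_inv M := by
    have h := fun v => (SimpleGraph.Subgraph.isPerfectMatching_iff.1 M.2 v).choose_spec
    refine Subtype.ext (SimpleGraph.Subgraph.ext ?_ ?_)
    · exact (Set.eq_univ_of_forall M.2.2).symm
    · funext a b
      exact propext ⟨fun hab => hab ▸ (h a).1, fun hab => ((h a).2 b hab).symm⟩
  right_inv f := by
    refine Subtype.ext (funext fun v => ?_)
    exact Eq.symm (SimpleGraph.Subgraph.isPerfectMatching_iff.1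
      (subgraphOfInvolution_isPerfectMatching f.1 f.2) v).choose_spec.1

/-- A perfect matching of `G □ H` is a matching of `H` in each layer `{i} × V`, together with a matching
of `G` in each fibre `U × {v}` covering exactly the vertices that the layers leave unmatched: each
vertex is moved along exactly one of the two coordinates. -/
def boxProdInvolutionEquiv {U V : Type*} (G : SimpleGraph U)
    (H : SimpleGraph V) :
    {f : U × V → U × V // ∀ p, f (f p) = p ∧ (G.boxProd H).Adj p (f p)} ≃
      (M : {M : U → V → V // ∀ i, IsMatchingInvolution H (M i)}) ×
        ((v : V) → {g : U → U // IsMatchingInvolution G g ∧ ∀ i, g i ≠ i ↔ M.1 i v = v}) where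
  toFun f := ⟨⟨fun i v => (f.1 (i, v)).2, fun i v => by
      obtain ⟨h1, h2⟩ := f.2 (i, v)
      rw [SimpleGraph.boxProd_adj] at h2
      obtain ⟨-, h⟩ | ⟨h, h'⟩ := h2
      · exact ⟨by dsimp only at h ⊢; rw [← h, ← h], Or.inl h.symm⟩
      · dsimp only at h'
        refine ⟨?_, Or.inr h⟩
        dsimp only
        rw [show (i, (f.1 (i, v)).2) = f.1 (i, v) from Prod.ext h' rfl, h1]⟩,
    fun v => ⟨fun i => (f.1 (i, v)).1, fun i => by
      obtain ⟨h1, h2⟩ := f.2 (i, v)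
      rw [SimpleGraph.boxProd_adj] at h2
      obtain ⟨h, h'⟩ | ⟨-, h⟩ := h2
      · dsimp only at h'
        refine ⟨?_, Or.inr h⟩
        dsimp only
        rw [show ((f.1 (i, v)).1, v) = f.1 (i, v) from Prod.ext rfl h', h1]
      · exact ⟨by dsimp only at h ⊢; rw [← h, ← h], Or.inl h.symm⟩, fun i => by
      have h2 := (f.2 (i, v)).2
      rw [SimpleGraph.boxProd_adj] at h2
      obtain ⟨h, h'⟩ | ⟨h', h⟩ := h2
      · exact iff_of_true h.ne' h'.symm
      · exact iff_of_false (fun hn => hn h.symm) h'.ne'⟩⟩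
  invFun p := ⟨fun q => ((p.2 q.2).1 q.1, p.1.1 q.1 q.2), by
    rintro ⟨i, v⟩
    obtain ⟨hM, hM'⟩ := p.1.2 i v
    obtain ⟨hg, hg'⟩ := (p.2 v).2.1 i
    have hx := (p.2 v).2.2 i
    rw [SimpleGraph.boxProd_adj]
    dsimp only
    by_cases h : p.1.1 i v = v
    · have hne := hx.2 h
      have hadj := hg'.resolve_left hne
      -- the partner of `i` in the fibre over `v` is not fixed there, hence is fixed in its layer
      have hx' := ((p.2 v).2.2 ((p.2 v).1 i)).1 (by rw [hg]; exact hne.symm)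
      rw [h]
      exact ⟨Prod.ext hg hx', Or.inl ⟨hadj, rfl⟩⟩
    · have heq : (p.2 v).1 i = i := by
        by_contra hne
        exact h (hx.1 hne)
      have hadj := hM'.resolve_left h
      have hx' : (p.2 (p.1.1 i v)).1 i = i := by
        by_contra hne
        exact h ((((p.2 (p.1.1 i v)).2.2 i).1 hne).symm.trans hM)
      rw [heq]
      exact ⟨Prod.ext hx' hM, Or.inr ⟨hadj, rfl⟩⟩⟩
  left_inv f := rfl
  right_inv p := rfl

/-- The layers in which the vertex `v` is left unmatched. -/
def unmatchedLayers {ι V : Type*} [Fintype ι] [DecidableEq V] (M : ι → V → V) (v : V) : Finset ι :=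
  {i | M i v = v}

@[simp]
theorem mem_unmatchedLayers {ι V : Type*} [Fintype ι] [DecidableEq V] {M : ι → V → V} {v : V}
    {i : ι} : i ∈ unmatchedLayers M v ↔ M i v = v := by
  simp [unmatchedLayers]

open Classical in
/-- The families of matchings of `T` indexed by `ι`, one in each layer. -/
noncomputable def layeredMatchings (ι : Type*) {V : Type*} [Fintype ι] [Fintype V]
    (T : SimpleGraph V) : Finset (ι → V → V) :=
  {M | ∀ i, IsMatchingInvolution T (M i)}

@[simp]
theorem mem_layeredMatchings {ι V : Type*} [Fintype ι] [Fintype V] {T : SimpleGraph V}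
    {M : ι → V → V} : M ∈ layeredMatchings ι T ↔ ∀ i, IsMatchingInvolution T (M i) := by
  simp [layeredMatchings]

open Classical in
theorem numPerfectMatchings_boxProd {U V : Type*} [Fintype U] [Fintype V]
    (G : SimpleGraph U) (H : SimpleGraph V) :
    numPerfectMatchings (G.boxProd H) =
      ∑ M ∈ layeredMatchings U H,
        ∏ v, #{g : U → U | IsMatchingInvolution G g ∧ ∀ i, g i ≠ i ↔ i ∈ unmatchedLayers M v} := by
  rw [numPerfectMatchings, Nat.card_congr ((perfectMatchingEquiv _).trans
    (boxProdInvolutionEquiv G H)), Nat.card_eq_fintype_card, Fintype.card_sigma,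
    Finset.sum_subtype (p := fun M : U → V → V => ∀ i, IsMatchingInvolution H (M i)) _
      (fun M => by simp)]
  refine Finset.sum_congr rfl fun M _ => ?_
  rw [Fintype.card_pi]
  refine Finset.prod_congr rfl fun v _ => ?_
  rw [Fintype.card_subtype]
  simp [unmatchedLayers]

/-! ### Local weights on the four-cycle -/

/-- The indicator, as a natural number, of the sets of vertices of the four-cycle that consist of `k`
vertices from each colour class: all vertices for `k = 2`, the ends of an edge for `k = 1`, and the
empty set for `k = 0`. -/
def balancedIndicator (k : ℕ) (S : Finset (Fin 4)) : ℕ :=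
  if #(S ∩ {0, 2}) = k ∧ #(S ∩ {1, 3}) = k then 1 else 0

/-- The weight at a vertex with parameter `x` whose unmatched layers form `S`: it is `x ^ 2` on the full
set, `x / √2` on each edge, `1` on the empty set, and `0` elsewhere. At `x = √2` it counts the
perfect matchings of the subgraph of the four-cycle induced on `S`. -/
noncomputable def cycleWeight (x : ℝ) (S : Finset (Fin 4)) : ℝ :=
  balancedIndicator 2 S * x ^ 2 + balancedIndicator 1 S * (x / √2) + balancedIndicator 0 S

set_option maxRecDepth 100000 in
theorem card_matchings_cycleGraph_four : ∀ S : Finset (Fin 4),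
    #{g : Fin 4 → Fin 4 |
        IsMatchingInvolution (SimpleGraph.cycleGraph 4) g ∧ ∀ i, g i ≠ i ↔ i ∈ S} =
      2 * balancedIndicator 2 S + balancedIndicator 1 S + balancedIndicator 0 S := by
  decide +kernel

/-- The coefficients of the monomials in the two weights in `sum_cycleWeight_sdiff_mul_compl`,
checked on all sixteen sets `S`. -/
theorem sum_balancedIndicator_mul_balancedIndicator : ∀ j k : Fin 3, ∀ S : Finset (Fin 4),
    ∑ R ∈ S.powerset, balancedIndicator j (S \ R) * balancedIndicator k Rᶜ =
      ![![balancedIndicator 2 S, 0, 0], ![balancedIndicator 1 S, 4 * balancedIndicator 2 S, 0],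
        ![balancedIndicator 0 S, balancedIndicator 1 S, balancedIndicator 2 S]] k j := by
  decide +kernel

/-- The weights are closed under absorbing a pendant vertex with parameter `y` into its neighbour with
parameter `x`. Here `R` is the set of layers in which the pendant edge is used. -/
theorem sum_cycleWeight_sdiff_mul_compl (x : ℝ) {y : ℝ} (hy : y ≠ 0) (S : Finset (Fin 4)) :
    ∑ R ∈ S.powerset, cycleWeight x (S \ R) * cycleWeight y Rᶜ =
      y ^ 2 * cycleWeight (x + y⁻¹) S := by
  have h (j k : Fin 3) := congrArg (Nat.cast (R := ℝ)) (sum_balancedIndicator_mul_balancedIndicator j k S)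
  push_cast at h
  have expand : ∑ R ∈ S.powerset, cycleWeight x (S \ R) * cycleWeight y Rᶜ =
      ∑ j : Fin 3, ∑ k : Fin 3, ![1, x / √2, x ^ 2] j * ![1, y / √2, y ^ 2] k *
        ∑ R ∈ S.powerset, (balancedIndicator j (S \ R) * balancedIndicator k Rᶜ : ℝ) := by
    simp only [Fin.sum_univ_three, Finset.mul_sum, ← Finset.sum_add_distrib]
    refine Finset.sum_congr rfl fun R _ => ?_
    simp [cycleWeight]
    ring
  rw [expand]
  simp only [h, Fin.sum_univ_three]
  have h2 : √2 ≠ 0 := by positivity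
  have hs : √2 ^ 2 = 2 := by norm_num
  simp [cycleWeight]
  field_simp
  ring_nf
  rw [hs]
  ring

theorem cycleWeight_univ (x : ℝ) : cycleWeight x univ = x ^ 2 := by
  rw [cycleWeight, show balancedIndicator 2 univ = 1 by decide, show balancedIndicator 1 univ = 0 by decide,
    show balancedIndicator 0 univ = 0 by decide]
  simp

/-! ### Removing a pendant edge -/

section Pendant

variable {V : Type*} {T : SimpleGraph V} {u v : V}

theorem IsMatchingInvolution.mono {G H : SimpleGraph V} (h : G ≤ H) {f : V → V}
    (hf : IsMatchingInvolution G f) : IsMatchingInvolution H f :=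
  fun w => ⟨(hf w).1, (hf w).2.imp_right fun a => h a⟩

theorem IsMatchingInvolution.deleteEdges {f : V → V} (hf : IsMatchingInvolution T f)
    (huv : u ≠ v) (hv : f v = v) : IsMatchingInvolution (T.deleteEdges {s(u, v)}) f := by
  intro w
  refine ⟨(hf w).1, (hf w).2.imp_right fun a => ?_⟩
  rw [SimpleGraph.deleteEdges_adj]
  refine ⟨a, fun h => ?_⟩
  rcases Sym2.eq_iff.1 (Set.mem_singleton_iff.1 h) with ⟨rfl, h'⟩ | ⟨rfl, h'⟩
  · have := (hf w).1
    rw [h', hv] at this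
    exact huv this.symm
  · exact huv (h'.symm.trans hv)

theorem IsMatchingInvolution.apply_eq_self_of_deleteEdges
    (hleaf : ∀ w, T.Adj v w → w = u) {f : V → V}
    (hf : IsMatchingInvolution (T.deleteEdges {s(u, v)}) f) : f v = v := by
  refine (hf v).2.resolve_right fun h => ?_
  rw [SimpleGraph.deleteEdges_adj] at h
  rw [hleaf _ h.1] at h
  exact h.2 (by simp [Sym2.eq_swap])

variable [DecidableEq V]

/-- Composing with `swap u v` adds the edge `uv` to a matching that avoids both ends, and removes it
from a matching that contains it. -/
theorem IsMatchingInvolution.comp_swap {f : V → V} (hf : IsMatchingInvolution T f)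
    (h : f u = u ∧ f v = v ∧ T.Adj u v ∨ f u = v ∧ f v = u) :
    IsMatchingInvolution T (f ∘ Equiv.swap u v) := by
  intro w
  have hinv (a b : V) (hab : f a = b) : f b = a := by rw [← hab, (hf a).1]
  rcases eq_or_ne w u with rfl | hwu
  · obtain ⟨h1, h2, h3⟩ | ⟨h1, h2⟩ := h
    · simp [h1, h2, h3]
    · simp [h2]
  rcases eq_or_ne w v with rfl | hwv
  · obtain ⟨h1, h2, h3⟩ | ⟨h1, h2⟩ := h
    · simp [h1, h2, h3.symm]
    · simp [h1]
  have hfu : f w ≠ u := fun h' => by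
    rcases h with ⟨h1, h2, h3⟩ | ⟨h1, h2⟩ <;> grind
  have hfv : f w ≠ v := fun h' => by
    rcases h with ⟨h1, h2, h3⟩ | ⟨h1, h2⟩ <;> grind
  simp only [Function.comp, Equiv.swap_apply_of_ne_of_ne hwu hwv,
    Equiv.swap_apply_of_ne_of_ne hfu hfv]
  exact hf w

/-- Adds or removes the edge `uv` in the layers belonging to `R`. -/
def toggleEdge {ι : Type*} [DecidableEq ι] (u v : V) (R : Finset ι) (M : ι → V → V) : ι → V → V :=
  fun i => if i ∈ R then M i ∘ Equiv.swap u v else M i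

theorem toggleEdge_toggleEdge {ι : Type*} [DecidableEq ι] (R : Finset ι) (M : ι → V → V) :
    toggleEdge u v R (toggleEdge u v R M) = M := by
  funext i w
  by_cases h : i ∈ R <;> simp [toggleEdge, h]

/-- A layered matching of `T` is a layered matching of `T` without the pendant edge `uv` together with
a set `R` of layers, all leaving `u` unmatched, to which the edge is added. -/
theorem sum_matchings_eq_sum_deleteEdges [Fintype V] {ι A : Type*} [Fintype ι] [DecidableEq ι]
    [AddCommMonoid A] (huv : T.Adj u v) (hleaf : ∀ w, T.Adj v w → w = u)
    (g : (ι → V → V) → A) :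
    ∑ M ∈ layeredMatchings ι T, g M =
      ∑ M ∈ layeredMatchings ι (T.deleteEdges {s(u, v)}),
        ∑ R ∈ (unmatchedLayers M u).powerset, g (toggleEdge u v R M) := by
  have hne : u ≠ v := huv.ne
  have hle : T.deleteEdges {s(u, v)} ≤ T := SimpleGraph.deleteEdges_le _
  rw [Finset.sum_sigma']
  refine Finset.sum_bij'
    (fun M _ => ⟨toggleEdge u v {i | M i v = u} M, ({i | M i v = u} : Finset ι)⟩)
    (fun p _ => toggleEdge u v p.2 p.1) ?_ ?_ ?_ ?_ ?_
  · intro M hM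
    rw [mem_layeredMatchings] at hM
    simp only [mem_sigma, mem_layeredMatchings, mem_powerset]
    refine ⟨fun i => ?_, fun i hi => ?_⟩
    · by_cases h : M i v = u
      · have h' : M i u = v := by rw [← h, (hM i v).1]
        simp only [toggleEdge, mem_filter, mem_univ, true_and, h, if_true]
        have : IsMatchingInvolution T (M i ∘ Equiv.swap u v) :=
          (hM i).comp_swap (Or.inr ⟨h', h⟩)
        exact this.deleteEdges hne (by simp [h'])
      · simp only [toggleEdge, mem_filter, mem_univ, true_and, h, if_false]
        exact (hM i).deleteEdges hne ((hM i v).2.resolve_right fun a => h (hleaf _ a))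
    · simp only [mem_filter, mem_univ, true_and] at hi
      simp [toggleEdge, hi]
  · rintro ⟨M, R⟩ hp
    simp only [mem_sigma, mem_layeredMatchings, mem_powerset] at hp ⊢
    intro i
    by_cases h : i ∈ R
    · have hu : M i u = u := by simpa using hp.2 h
      have hv := (hp.1 i).apply_eq_self_of_deleteEdges hleaf
      simp only [toggleEdge, h, if_true]
      exact ((hp.1 i).mono hle).comp_swap (Or.inl ⟨hu, hv, huv⟩)
    · simpa only [toggleEdge, h, if_false] using (hp.1 i).mono hle
  · intro M _
    exact toggleEdge_toggleEdge _ _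
  · rintro ⟨M, R⟩ hp
    simp only [mem_sigma, mem_layeredMatchings, mem_powerset] at hp
    have hR : ({i | toggleEdge u v R M i v = u} : Finset ι) = R := by
      ext i
      have hv := (hp.1 i).apply_eq_self_of_deleteEdges hleaf
      by_cases h : i ∈ R
      · have hu : M i u = u := by simpa using hp.2 h
        rw [mem_filter]
        simp [toggleEdge, h, hu]
      · rw [mem_filter]
        simp [toggleEdge, h, hv, hne.symm]
    simp only [hR, toggleEdge_toggleEdge]
  · intro M _
    rw [toggleEdge_toggleEdge]

/-- The sum over all quadruples of matchings of `T` of the product of the local weights. With all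
parameters equal to `√2` it counts the perfect matchings of the product of the four-cycle and `T`. -/
noncomputable def cyclePartition [Fintype V] (T : SimpleGraph V) (x : V → ℝ) : ℝ :=
  ∑ M ∈ layeredMatchings (Fin 4) T,
    ∏ v, cycleWeight (x v) (unmatchedLayers M v)

/-- Deleting a pendant edge and adding the inverse parameter of the leaf to that of its neighbour
preserves the partition function: the leaf becomes isolated, and its weight `x v ^ 2` is the factor
produced by `sum_cycleWeight_sdiff_mul_compl`. -/
theorem cyclePartition_deleteEdges [Fintype V] (huv : T.Adj u v)
    (hleaf : ∀ w, T.Adj v w → w = u) (x : V → ℝ) (hx : x v ≠ 0) :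
    cyclePartition T x =
      cyclePartition (T.deleteEdges {s(u, v)}) (Function.update x u (x u + (x v)⁻¹)) := by
  have hne : u ≠ v := huv.ne
  rw [cyclePartition, cyclePartition, sum_matchings_eq_sum_deleteEdges huv hleaf]
  refine Finset.sum_congr rfl fun M hM => ?_
  rw [mem_layeredMatchings] at hM
  have hv i := (hM i).apply_eq_self_of_deleteEdges hleaf
  have split (f : V → ℝ) : ∏ w, f w = f u * f v * ∏ w ∈ {u, v}ᶜ, f w := by
    rw [← Finset.prod_mul_prod_compl {u, v} f, Finset.prod_pair hne]
  simp only [split]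
  -- after the deletion `v` is isolated, so it is unmatched in every layer
  have hvuniv : unmatchedLayers M v = univ := by ext i; simp [hv]
  have hterm : ∀ R ∈ (unmatchedLayers M u).powerset,
      cycleWeight (x u) (unmatchedLayers (toggleEdge u v R M) u) *
        cycleWeight (x v) (unmatchedLayers (toggleEdge u v R M) v) *
        ∏ w ∈ {u, v}ᶜ, cycleWeight (x w) (unmatchedLayers (toggleEdge u v R M) w) =
      cycleWeight (x u) (unmatchedLayers M u \ R) * cycleWeight (x v) Rᶜ *
        ∏ w ∈ {u, v}ᶜ, cycleWeight (x w) (unmatchedLayers M w) := by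
    intro R hR
    rw [mem_powerset] at hR
    have hu i (hi : i ∈ R) : M i u = u := by simpa using hR hi
    congr 1
    · congr 2
      · ext i
        by_cases h : i ∈ R <;> simp [toggleEdge, h, hv, hne.symm]
      · ext i
        by_cases h : i ∈ R <;> simp [toggleEdge, h, hv, hu, hne]
    · refine Finset.prod_congr rfl fun w hw => ?_
      simp only [mem_compl, mem_insert, mem_singleton, not_or] at hw
      congr 1
      ext i
      by_cases h : i ∈ R <;>
        simp [toggleEdge, h, Equiv.swap_apply_of_ne_of_ne hw.1 hw.2]
  rw [Finset.sum_congr rfl hterm, ← Finset.sum_mul, sum_cycleWeight_sdiff_mul_compl _ hx, hvuniv]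
  rw [Function.update_self, Function.update_of_ne hne.symm, cycleWeight_univ, mul_comm (x v ^ 2)]
  congr 1
  refine Finset.prod_congr rfl fun w hw => ?_
  simp only [mem_compl, mem_insert, mem_singleton, not_or] at hw
  rw [Function.update_of_ne hw.1]

open Classical in
/-- The matrix `diag x + i A(T)`. -/
noncomputable def signedMatrix (T : SimpleGraph V) (x : V → ℝ) :
    Matrix V V ℂ :=
  Matrix.diagonal (fun w => (x w : ℂ)) + Complex.I • T.adjMatrix ℂ

/-- The determinant of `diag x + i A(T)` obeys the same recursion as the partition function, by one step
of Gaussian elimination with the diagonal entry of the leaf as pivot. -/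
theorem det_signedMatrix_deleteEdges [Fintype V] (huv : T.Adj u v)
    (hleaf : ∀ w, T.Adj v w → w = u) (x : V → ℝ) (hx : x v ≠ 0) :
    (signedMatrix T x).det =
      (signedMatrix (T.deleteEdges {s(u, v)}) (Function.update x u (x u + (x v)⁻¹))).det := by
  have hne : u ≠ v := huv.ne
  rw [← Matrix.det_updateRow_add_smul_self _ hne (-Complex.I / x v),
    ← Matrix.det_updateCol_add_smul_self _ hne (-Complex.I / x v)]
  congr 1
  classical
  have hx' : (x v : ℂ) ≠ 0 := by exact_mod_cast hx
  have hAdj w : T.Adj v w ↔ w = u := ⟨hleaf w, fun h => h ▸ huv.symm⟩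
  have hAdj' w : T.Adj w v ↔ w = u := by rw [T.adj_comm, hAdj]
  ext a b
  have key : (T.deleteEdges {s(u, v)}).Adj a b ↔ T.Adj a b ∧ a ≠ v ∧ b ≠ v := by
    rw [SimpleGraph.deleteEdges_adj]
    refine and_congr_right fun h => ?_
    simp only [Set.mem_singleton_iff, Sym2.eq_iff]
    grind
  have hent (y : V → ℝ) : signedMatrix (T.deleteEdges {s(u, v)}) y a b =
      (if a = b then (y a : ℂ) else 0) + if T.Adj a b ∧ a ≠ v ∧ b ≠ v then Complex.I else 0 := by
    simp [signedMatrix, Matrix.diagonal_apply, SimpleGraph.adjMatrix_apply, key,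
      -SimpleGraph.deleteEdges_adj]
  rw [hent]
  clear key hent
  by_cases hau : a = u <;> by_cases hbu : b = u <;> by_cases hav : a = v <;> by_cases hbv : b = v <;>
    subst_vars <;>
    simp_all [signedMatrix, Matrix.updateRow_apply, Matrix.diagonal_apply,
      SimpleGraph.adjMatrix_apply]
  · rw [if_neg (Ne.symm hne), zero_add, div_mul_eq_mul_div, neg_mul, Complex.I_mul_I, neg_neg,
      one_div]
  · rw [if_neg (Ne.symm hbu), if_neg (Ne.symm hbv)]
    simp [Ne.symm hbu]


end Pendant

/-! ### Forests -/

/-- A forest with an edge has a leaf `v`, with neighbour `u`. -/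
theorem SimpleGraph.IsAcyclic.exists_pendant {V : Type*} [Finite V] {T : SimpleGraph V}
    (hT : T.IsAcyclic) {a b : V} (hab : T.Adj a b) :
    ∃ u v, T.Adj u v ∧ ∀ w, T.Adj v w → w = u := by
  classical
  have := Fintype.ofFinite V
  set c := T.connectedComponentMk a
  have hb : b ∈ c.supp := SimpleGraph.ConnectedComponent.sound hab.symm.reachable
  have : Nontrivial c := ⟨⟨a, rfl⟩, ⟨b, hb⟩, fun h => hab.ne (congrArg Subtype.val h)⟩
  obtain ⟨v, hv⟩ := (hT.isTree_connectedComponent c).exists_vert_degree_one_of_nontrivial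
  obtain ⟨u, huv, hu⟩ := SimpleGraph.degree_eq_one_iff_existsUnique_adj.1 hv
  refine ⟨u, v, huv.symm, fun w hw => ?_⟩
  have hwc : w ∈ c.supp := (SimpleGraph.ConnectedComponent.mem_supp_congr_adj c hw).1 v.2
  exact congrArg Subtype.val (hu ⟨w, hwc⟩ hw)

theorem cyclePartition_bot {V : Type*} [Fintype V] [DecidableEq V] (x : V → ℝ) :
    cyclePartition ⊥ x = ∏ v, x v ^ 2 := by
  have h : layeredMatchings (Fin 4) (⊥ : SimpleGraph V) = {fun _ => id} := by
    ext M
    simp only [mem_layeredMatchings, IsMatchingInvolution, SimpleGraph.bot_adj, or_false,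
      mem_singleton]
    refine ⟨fun h => funext fun i => funext fun v => (h i v).2, ?_⟩
    rintro rfl
    simp
  have hu (v : V) : unmatchedLayers (fun _ : Fin 4 => id) v = univ := by ext; simp
  simp [cyclePartition, h, hu, cycleWeight_univ]

theorem SimpleGraph.IsAcyclic.cyclePartition_eq_det_sq {V : Type*} [Fintype V] [DecidableEq V]
    {T : SimpleGraph V} (hT : T.IsAcyclic) {x : V → ℝ} (hx : ∀ v, 0 < x v) :
    (cyclePartition T x : ℂ) = (signedMatrix T x).det ^ 2 := by
  induction hn : T.edgeSet.ncard using Nat.strong_induction_on generalizing T x with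
  | _ n ih =>
    subst hn
    by_cases hbot : T = ⊥
    · subst hbot
      have : signedMatrix ⊥ x = Matrix.diagonal fun w => (x w : ℂ) := by
        ext; simp [signedMatrix, SimpleGraph.adjMatrix_apply]
      rw [cyclePartition_bot, this, Matrix.det_diagonal, Finset.prod_pow]
      push_cast
      rfl
    · obtain ⟨a, b, hab⟩ := SimpleGraph.ne_bot_iff_exists_adj.1 hbot
      obtain ⟨u, v, huv, hleaf⟩ := hT.exists_pendant hab
      rw [cyclePartition_deleteEdges huv hleaf x (hx v).ne',
        det_signedMatrix_deleteEdges huv hleaf x (hx v).ne']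
      refine ih _ ?_ (hT.anti (SimpleGraph.deleteEdges_le _)) (fun w => ?_) rfl
      · rw [SimpleGraph.edgeSet_deleteEdges]
        exact Set.ncard_lt_ncard (Set.sdiff_singleton_ssubset.2 huv) (Set.toFinite _)
      · rcases eq_or_ne w u with rfl | hw
        · simpa using add_pos (hx w) (inv_pos.2 (hx v))
        · simpa [hw] using hx w

theorem numPerfectMatchings_eq_cyclePartition {V : Type*} [Fintype V] [DecidableEq V]
    (T : SimpleGraph V) :
    (numPerfectMatchings (SimpleGraph.boxProd (SimpleGraph.cycleGraph 4) T) : ℝ) =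
      cyclePartition T (fun _ => √2) := by
  rw [numPerfectMatchings_boxProd, cyclePartition]
  push_cast
  refine Finset.sum_congr (by congr!) fun M _ => Finset.prod_congr rfl fun v _ => ?_
  set S := unmatchedLayers M v
  have h := card_matchings_cycleGraph_four S
  have h2 : √2 ≠ 0 := by positivity
  have hcast : cycleWeight √2 S =
      ((2 * balancedIndicator 2 S + balancedIndicator 1 S + balancedIndicator 0 S : ℕ) : ℝ) := by
    rw [cycleWeight, div_self h2, Real.sq_sqrt zero_le_two]
    push_cast
    ring
  rw [hcast, ← h]
  congr! 2
  ext
  simp [S]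

theorem eval_charpoly_adjMatrix_I_mul {V : Type*} [Fintype V] [DecidableEq V] (T : SimpleGraph V)
    [DecidableRel T.Adj] (x : ℝ) :
    (T.adjMatrix ℂ).charpoly.eval (Complex.I * x) =
      Complex.I ^ Fintype.card V * (signedMatrix T fun _ => x).det := by
  rw [Matrix.eval_charpoly, ← Matrix.det_smul]
  congr 1
  ext a b
  by_cases hab : a = b <;> by_cases h : T.Adj a b <;>
    simp [signedMatrix, SimpleGraph.adjMatrix_apply, hab, h]

/-! ### Values of the characteristic polynomial and sizes of matchings -/

/-- The values at `z` of integer polynomials lie in `ℤ + ℤ z` when `z ^ 2` is an integer. -/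
theorem Polynomial.exists_eval₂_eq_add_mul_of_sq_eq {R : Type*} [CommRing R]
    (p : Polynomial ℤ) {z : R} {d : ℤ}
    (hz : z ^ 2 = d) : ∃ a b : ℤ, p.eval₂ (Int.castRingHom R) z = a + b * z := by
  induction p using Polynomial.induction_on with
  | C a => exact ⟨a, 0, by rw [Polynomial.eval₂_C]; simp⟩
  | add p q hp hq =>
    obtain ⟨a, b, h⟩ := hp
    obtain ⟨a', b', h'⟩ := hq
    exact ⟨a + a', b + b', by rw [Polynomial.eval₂_add, h, h']; push_cast; ring⟩
  | monomial n c h =>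
    obtain ⟨a, b, h⟩ := h
    refine ⟨b * d, a, ?_⟩
    rw [pow_succ, ← mul_assoc, Polynomial.eval₂_mul, h, Polynomial.eval₂_X]
    push_cast
    rw [← hz]
    ring

theorem SimpleGraph.Subgraph.IsMatching.two_mul_ncard_edgeSet_le {V : Type*} [Fintype V]
    {G : SimpleGraph V} {M : G.Subgraph} (hM : M.IsMatching) : 2 * M.edgeSet.ncard ≤ Fintype.card V := by
  classical
  have h := M.spanningCoe.sum_degrees_eq_twice_card_edges
  have hd : ∀ v, M.spanningCoe.degree v ≤ 1 := by
    intro v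
    rw [SimpleGraph.degree, Finset.card_le_one]
    intro a ha b hb
    simp only [SimpleGraph.mem_neighborFinset, SimpleGraph.Subgraph.spanningCoe_adj] at ha hb
    exact hM.eq_of_adj_left ha hb
  have hc : M.edgeSet.ncard = #M.spanningCoe.edgeFinset := by
    rw [← Set.ncard_coe_finset, SimpleGraph.coe_edgeFinset, SimpleGraph.Subgraph.edgeSet_spanningCoe]
  rw [hc, ← h]
  simpa using Finset.sum_le_sum (s := univ) fun v _ => hd v

theorem exists_isMaximumMatchingSize {V : Type*} [Fintype V] (G : SimpleGraph V) :
    ∃ r s : ℕ, IsMaximumMatchingSize G r ∧ Fintype.card V = s + 2 * r := by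
  let S : Set ℕ := {k | ∃ M : G.Subgraph, M.IsMatching ∧ M.edgeSet.ncard = k}
  have hne : S.Nonempty := ⟨0, ⊥, fun v hv => hv.elim, by simp⟩
  have hb : BddAbove S := ⟨Fintype.card V, by
    rintro k ⟨M, hM, rfl⟩
    have := hM.two_mul_ncard_edgeSet_le
    omega⟩
  have hmax : IsGreatest S (sSup S) := ⟨Nat.sSup_mem hne hb, fun k hk => le_csSup hb hk⟩
  obtain ⟨M, hM, hk⟩ := hmax.1
  have := hM.two_mul_ncard_edgeSet_le
  exact ⟨sSup S, Fintype.card V - 2 * sSup S, hmax, by omega⟩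

/-- If `± (a + b i √2) ^ 2` is a natural number, its imaginary part `± 2 a b √2` vanishes, and only its
real part `± (a ^ 2 - 2 b ^ 2)` remains. -/
theorem eq_zero_or_eq_zero_of_natCast_eq {N n : ℕ} {a b : ℤ}
    (h : (N : ℂ) = (-1) ^ n * (a + b * (Complex.I * (√2 : ℝ))) ^ 2) :
    (a = 0 ∨ b = 0) ∧ (N : ℤ) = (-1) ^ n * (a ^ 2 - 2 * b ^ 2) := by
  have hs : ((√2 : ℝ) : ℂ) ^ 2 = 2 := by
    rw [← Complex.ofReal_pow, Real.sq_sqrt zero_le_two, Complex.ofReal_ofNat]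
  have h' : (N : ℂ) = (((-1) ^ n * (a ^ 2 - 2 * b ^ 2) : ℝ) : ℂ) +
      (((-1) ^ n * (2 * a * b * √2) : ℝ) : ℂ) * Complex.I := by
    rw [h]
    push_cast
    linear_combination (-1) ^ n * (b : ℂ) ^ 2 * ((√2 : ℝ) : ℂ) ^ 2 * Complex.I_sq -
      (-1) ^ n * (b : ℂ) ^ 2 * hs
  constructor
  · have := congrArg Complex.im h'
    simp only [Complex.natCast_im, Complex.add_im, Complex.ofReal_im,
      Complex.im_ofReal_mul, Complex.I_im] at this
    simpa using this
  · have := congrArg Complex.re h'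
    simp only [Complex.natCast_re, Complex.add_re, Complex.ofReal_re, Complex.re_ofReal_mul,
      Complex.I_re, mul_zero, add_zero] at this
    exact_mod_cast this

theorem corollary10 {V : Type*} [Fintype V] [DecidableEq V] (T : SimpleGraph V)
    [DecidableRel T.Adj] (hT : T.IsTree) :
    (IsSquare (numPerfectMatchings (SimpleGraph.boxProd (SimpleGraph.cycleGraph 4) T)) ∨
      ∃ m : ℕ, numPerfectMatchings (SimpleGraph.boxProd (SimpleGraph.cycleGraph 4) T) = 2 * m ^ 2) ∧
    ((∃ M : T.Subgraph, M.IsPerfectMatching) →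
      IsSquare (numPerfectMatchings (SimpleGraph.boxProd (SimpleGraph.cycleGraph 4) T))) ∧
    ∃ r s : ℕ, IsMaximumMatchingSize T r ∧ Fintype.card V = s + 2 * r ∧
      (numPerfectMatchings (SimpleGraph.boxProd (SimpleGraph.cycleGraph 4) T) : ℂ) =
        (-1) ^ s * ((T.adjMatrix ℂ).charpoly.eval (Complex.I * (Real.sqrt 2 : ℂ))) ^ 2 := by
  set N := numPerfectMatchings (SimpleGraph.boxProd (SimpleGraph.cycleGraph 4) T)
  have hN : (N : ℂ) = (-1) ^ Fintype.card V *
      ((T.adjMatrix ℂ).charpoly.eval (Complex.I * (Real.sqrt 2 : ℂ))) ^ 2 := by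
    have h := hT.isAcyclic.cyclePartition_eq_det_sq (x := fun _ => √2) (fun _ => by positivity)
    rw [← numPerfectMatchings_eq_cyclePartition, Complex.ofReal_natCast] at h
    rw [h, eval_charpoly_adjMatrix_I_mul, mul_pow, ← pow_mul, mul_comm _ 2, pow_mul, Complex.I_sq,
      ← mul_assoc, ← mul_pow]
    simp
  obtain ⟨a, b, hab⟩ := Polynomial.exists_eval₂_eq_add_mul_of_sq_eq (T.adjMatrix ℤ).charpoly
    (z := Complex.I * (Real.sqrt 2 : ℂ)) (d := -2) (by
      rw [mul_pow, Complex.I_sq, ← Complex.ofReal_pow, Real.sq_sqrt zero_le_two]; simp)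
  have hchar : (T.adjMatrix ℂ).charpoly = (T.adjMatrix ℤ).charpoly.map (Int.castRingHom ℂ) := by
    rw [← Matrix.charpoly_map]
    congr 1
    ext i j
    simp [SimpleGraph.adjMatrix_apply]
  rw [← Polynomial.eval_map, ← hchar] at hab
  obtain ⟨h0, hNab⟩ := eq_zero_or_eq_zero_of_natCast_eq (hab ▸ hN)
  refine ⟨?_, ?_, ?_⟩
  · have habs := congrArg Int.natAbs hNab
    rw [Int.natAbs_mul, Int.natAbs_pow, Int.natAbs_neg, Int.natAbs_one, one_pow, one_mul,
      Int.natAbs_natCast] at habs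
    rcases h0 with rfl | rfl
    · exact Or.inr ⟨b.natAbs, by simpa [Int.natAbs_mul, Int.natAbs_pow] using habs⟩
    · exact Or.inl ⟨a.natAbs, by simpa [Int.natAbs_pow, sq, Int.natAbs_mul] using habs⟩
  · rintro ⟨M, hM⟩
    rw [hM.even_card.neg_one_pow, one_mul] at hNab
    -- for `a = 0` the count would be `-2 * b ^ 2`, which is nonnegative only if `b = 0`
    have hb : b = 0 := by
      rcases h0 with rfl | hb
      · nlinarith [sq_nonneg b, Int.natCast_nonneg N]
      · exact hb
    subst hb
    refine ⟨a.natAbs, ?_⟩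
    zify
    rw [hNab, abs_mul_abs_self]
    ring
  · obtain ⟨r, s, hr, hs⟩ := exists_isMaximumMatchingSize T
    refine ⟨r, s, hr, hs, ?_⟩
    rw [hN, hs, pow_add, pow_mul]
    simp
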